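/- Let $\mathbb{Q}[h_r\mid r>0]$ be the polynomial $\mathbb{Q}$-algebra in commuting variables $h_r$, $r\in\mathbb{Z}_{>0}$. For a sequence $a:\mathbb{Z}_{>0}\to\mathbb{Q}$ define $\hat h^{\{a\}}_k$ ($k\ge 0$) by $$\sum_{k\ge 0}\hat h^{\{a\}}_k u^k=\exp\Big(\sum_{r>0}(-1)^{r-1}\frac{a_r h_r}{r}u^r\Big)\in\mathbb{Q}[h_r\mid r>0][[u]].$$ Let $\hat h_k=\hat h^{\{a\}}_k$ for $a_r=1$ for all $r$; let $\check h_k=\hat h^{\{a\}}_k$ for $a_r=\tfrac12$ for all $r$; and let $\bar h_k=\hat h^{\{a\}}_k$ for $a_r=1$ if $r$ is even and $a_r=0$ if $r$ is odd. For $m>0$ let $\lambda_m$ be the $\mathbb{Q}$-algebra endomorphism of $\mathbb{Q}[h_r\mid r>0]$ with $\lambda_m(h_r)=h_{mr}$. Let $\mathbb{Z}^{(mix)}[h_r\mid r>0]$ be the $\mathbb{Z}$-subalgebra of $\mathbb{Q}[h_r\mid r>0]$ generated by $\{\hat h_r,\bar h_r\mid r>0\}$, and let $\mathbb{Z}[\bar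 h_{2k}\mid k>0]$ be the $\mathbb{Z}$-subalgebra generated by $\{\bar h_{2k}\mid k>0\}$. For finitely supported $k:\mathbb{Z}_{>0}\to\mathbb{N}$ put $$b'_k=\prod_{m>0,\ m\text{ odd}}\lambda_m(\hat h_{k_m})\prod_{m>0,\ m\text{ even}}\lambda_m(\check h_{k_m}),$$ and let $\mathbb{Z}'_\lambda[h_r\mid r>0]$ be the $\mathbb{Z}$-linear span of $B'_\lambda=\{b'_k\}$. Then: 1. $\mathbb{Z}^{(mix)}[h_r\mid r>0]=\mathbb{Z}'_\lambda[h_r\mid r>0]$. 2. $\mathbb{Z}^{(mix)}[h_r\mid r>0]$ is an integral form of $\mathbb{Q}[h_r\mid r>0]$, that is, it is a free $\mathbb{Z}$-module and the natural map $\mathbb{Q}\otimes_{\mathbb{Z}}\mathbb{Z}^{(mix)}[h_r\mid r>0]\to\mathbb{Q}[h_r\mid r>0]$ is an isomorphism. 3. The family $(b'_k)$, indexed by the finitely supported $k:\mathbb{Z}_{>0}\to\mathbb{N}$, is a $\mathbb{Z}$-basis of $\mathbb{Z}^{(mix)}[h_r\mid r>0]$. 4. $\mathbb{Z}^{(mix)}[h_r\mid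 r>0]$ is a free $\mathbb{Z}[\bar h_{2k}\mid k>0]$-module, with basis the family of products $\prod_{m>0}\lambda_{2m-1}(\hat h_{k_m})$ indexed by the finitely supported $k:\mathbb{Z}_{>0}\to\mathbb{N}$. -/

import Mathlib

open Finset

noncomputable section

namespace MixedSym

/-- The polynomial algebra `ℚ[h_r | r > 0]`. -/
abbrev QH : Type := MvPolynomial ℕ+ ℚ

/-- The generator `h_r`. -/
def h (r : ℕ+) : QH := MvPolynomial.X r

/-- The series `∑_{r > 0} (-1)^(r-1) (a_r h_r / r) u^r`. -/
def logSeries (a : ℕ+ → ℚ) : PowerSeries QH :=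
  PowerSeries.mk fun r =>
    if hr : 0 < r then ((-1 : ℚ) ^ (r - 1) * a (r.toPNat hr) / (r : ℚ)) • h (r.toPNat hr) else 0

theorem constantCoeff_logSeries (a : ℕ+ → ℚ) :
    PowerSeries.constantCoeff (logSeries a) = 0 := by
  rw [← PowerSeries.coeff_zero_eq_constantCoeff_apply]
  simp [logSeries]

theorem hasSubst_logSeries (a : ℕ+ → ℚ) : PowerSeries.HasSubst (logSeries a) :=
  PowerSeries.HasSubst.of_constantCoeff_zero' (constantCoeff_logSeries a)

/-- The series `exp (∑_{r > 0} (-1)^(r-1) (a_r h_r / r) u^r)`; the substitution is legitimate by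
`hasSubst_logSeries`. -/
def hatSeries (a : ℕ+ → ℚ) : PowerSeries QH :=
  (PowerSeries.exp ℚ).subst (logSeries a)

/-- The coefficient of `u^k` in `hatSeries a`. -/
def hatCoeff (a : ℕ+ → ℚ) (k : ℕ) : QH := PowerSeries.coeff k (hatSeries a)

/-- The sequence equal to `m` at the multiples of `m` and to `0` elsewhere. -/
def multSeq (m : ℕ+) : ℕ+ → ℚ := fun r => if (m : ℕ) ∣ (r : ℕ) then (m : ℚ) else 0

/-- `ĥ_k`, from the constant sequence `1`. -/
def hHat (k : ℕ) : QH := hatCoeff (fun _ => 1) k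

/-- `ȟ_k`, from the constant sequence `1/2`. -/
def hCheck (k : ℕ) : QH := hatCoeff (fun _ => 1 / 2) k

/-- `h̄_k`, from the sequence that is `1` at even and `0` at odd indices. -/
def hBar (k : ℕ) : QH := hatCoeff (fun r => 1 / 2 * multSeq 2 r) k

theorem hatCoeff_zero (a : ℕ+ → ℚ) : hatCoeff a 0 = 1 := by
  rw [hatCoeff, hatSeries, PowerSeries.coeff_subst' (hasSubst_logSeries a),
    finsum_eq_single _ 0]
  · simp
  · intro n hn
    rw [PowerSeries.coeff_zero_eq_constantCoeff_apply, map_pow, constantCoeff_logSeries,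
      zero_pow hn, smul_zero]

/-- The algebra endomorphism `λ_m` with `λ_m (h_r) = h_{mr}`. -/
def lam (m : ℕ+) : QH →ₐ[ℚ] QH := MvPolynomial.aeval fun r => h (m * r)

/-- The `ℤ`-subalgebra generated by all `ĥ_r` and `h̄_r`, `r > 0`. -/
def mixedAlgebra : Subalgebra ℤ QH :=
  Algebra.adjoin ℤ ({x | ∃ r : ℕ, 0 < r ∧ x = hHat r} ∪ {x | ∃ r : ℕ, 0 < r ∧ x = hBar r})

/-- The `ℤ`-subalgebra `ℤ[h̄_{2k} | k > 0]`. -/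
def barAlgebra : Subalgebra ℤ QH :=
  Algebra.adjoin ℤ {x | ∃ k : ℕ, 0 < k ∧ x = hBar (2 * k)}

theorem barAlgebra_le_mixedAlgebra : barAlgebra ≤ mixedAlgebra := by
  refine Algebra.adjoin_mono ?_
  rintro x ⟨k, hk, rfl⟩
  exact Or.inr ⟨2 * k, by omega, rfl⟩

/-- `mixedAlgebra`, viewed as a module over `barAlgebra` by multiplication. -/
def mixedModule : Submodule barAlgebra QH where
  carrier := mixedAlgebra
  add_mem' := fun hx hy => mixedAlgebra.add_mem hx hy
  zero_mem' := mixedAlgebra.zero_mem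
  smul_mem' := fun c _ hx => mixedAlgebra.mul_mem (barAlgebra_le_mixedAlgebra c.2) hx

/-- The element `b'_k = ∏_{m odd} λ_m(ĥ_{k_m}) ∏_{m even} λ_m(ȟ_{k_m})`. The factors with
`k_m = 0` are `1` (see `hatCoeff_zero`). -/
def bPrime (k : ℕ+ →₀ ℕ) : QH :=
  (∏ m ∈ k.support.filter (fun m : ℕ+ => Odd (m : ℕ)), lam m (hHat (k m))) *
    ∏ m ∈ k.support.filter (fun m : ℕ+ => Even (m : ℕ)), lam m (hCheck (k m))

/-- The `ℤ`-linear span of the `b'_k`. -/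
def lambdaSpan : Submodule ℤ QH := Submodule.span ℤ (Set.range bPrime)

/-- The odd number `2m - 1`, for `m > 0`. -/
def oddIndex (m : ℕ+) : ℕ+ := ⟨2 * (m : ℕ) - 1, by have := m.pos; omega⟩

/-- The element `∏_{m > 0} λ_{2m-1}(ĥ_{k_m})`. -/
def oddProd (k : ℕ+ →₀ ℕ) : QH := ∏ m ∈ k.support, lam (oddIndex m) (hHat (k m))

/-- A `ℤ`-subalgebra `S` of a `ℚ`-algebra `A` is an integral form of `A` if it is a free
`ℤ`-module and the natural map `ℚ ⊗_ℤ S → A` is an isomorphism. -/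
def IsIntegralForm {A : Type*} [Ring A] [Algebra ℚ A] (S : Subalgebra ℤ A) : Prop :=
  Module.Free ℤ S ∧ IsBaseChange ℚ S.val.toLinearMap

end MixedSym

end

/-! Write `Ĥ(u)` for the generating series of the `ĥ_k`. All series identities are checked on
logarithmic derivatives, which are linear in the `h_r`.

The ring generated by the `ĥ_k` has the products `∏ λ_m(ĥ_{k_m})` as a spanning set. For one
inclusion, factor `∏_j (1 + x_j u)` as `∏_m (1 + w_m u^m)` up to a given order, with `w_m` in
`ℤ[x]`. Comparing logarithmic derivatives and multiplying the `r`-th coefficient by `h_r` turns this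
into `∏_j Ĥ(x_j u) = ∏_m (λ_m Ĥ)(w_m u^m)` up to that order; the coefficients of monomials in `x`
give `prod_hHat_mem_hatSpan`. Conversely `∏_j Ĥ(ζ^j u) = (λ_m Ĥ)(± u^m)`, the product running over
the powers of an `m`-th root of unity, gives `lam_hHat_mem_hatAlgebra`.

The map `halfLam` carries this ring onto `ℤ[h̄_{2k}]` and `λ_m(ĥ_k)` to `λ_{2m}(ȟ_k)`, so
`ℤ[h̄_{2k}]` is spanned by the even parts of the `b'_k`. It contains `λ_{2m}(ĥ_k)`, because `λ_{2m}
Ĥ` is a square. Even factors can thus be absorbed, and the mixed algebra is the span of the odd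
products times `ℤ[h̄_{2k}]` (`mixedAlgebra_eq_lambdaSpan`).

Independence is triangularity: by `hasLeadingExponent_bPrime`, the unique term of top degree in
`b'_k` is a multiple of the monomial `h^k`. -/

noncomputable section

namespace MixedSym

/-! ### Power series determined by their logarithmic derivative. -/

section LogDerivative

open PowerSeries

variable {R : Type*} [CommRing R]

/-- `f` is a power series with constant term `1` and logarithmic derivative `Q / X`. -/
def IsLogExp (Q f : R⟦X⟧) : Prop :=
  constantCoeff f = 1 ∧ X * derivative R f = Q * f

theorem coeff_X_mul_derivative (f : R⟦X⟧) (n : ℕ) :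
    coeff n (X * derivative R f) = n * coeff n f := by
  cases n with
  | zero => simp
  | succ n => rw [coeff_succ_X_mul, coeff_derivative]; push_cast; ring

namespace IsLogExp

variable {Q Q' f g : R⟦X⟧}

theorem coeff_mul (hf : IsLogExp Q f) (n : ℕ) :
    n * coeff n f = ∑ x ∈ antidiagonal n, coeff x.1 Q * coeff x.2 f := by
  rw [← coeff_X_mul_derivative, hf.2, PowerSeries.coeff_mul]

theorem one : IsLogExp (0 : R⟦X⟧) 1 := ⟨by simp, by simp⟩

theorem mul (hf : IsLogExp Q f) (hg : IsLogExp Q' g) : IsLogExp (Q + Q') (f * g) := by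
  refine ⟨by simp [hf.1, hg.1], ?_⟩
  have h1 := hf.2
  have h2 := hg.2
  rw [Derivation.leibniz, smul_eq_mul, smul_eq_mul]
  linear_combination f * h2 + g * h1

theorem prod {ι : Type*} (s : Finset ι) {Q f : ι → R⟦X⟧} (h : ∀ i ∈ s, IsLogExp (Q i) (f i)) :
    IsLogExp (∑ i ∈ s, Q i) (∏ i ∈ s, f i) := by
  classical
  induction s using Finset.induction_on with
  | empty => simpa using one
  | insert a s ha ih =>
    rw [sum_insert ha, prod_insert ha]
    exact (h a (mem_insert_self a s)).mul (ih fun i hi => h i (mem_insert_of_mem hi))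

theorem map {S : Type*} [CommRing S] (φ : R →+* S) (hf : IsLogExp Q f) :
    IsLogExp (PowerSeries.map φ Q) (PowerSeries.map φ f) := by
  have h0 : coeff 0 f = 1 := by simpa using hf.1
  refine ⟨by rw [← coeff_zero_eq_constantCoeff_apply, coeff_map, h0, map_one], ?_⟩
  rw [← map_mul, ← hf.2]
  ext n
  rw [coeff_X_mul_derivative, coeff_map, coeff_map, coeff_X_mul_derivative, _root_.map_mul,
    map_natCast]

theorem rescale (c : R) (hf : IsLogExp Q f) :
    IsLogExp (PowerSeries.rescale c Q) (PowerSeries.rescale c f) := by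
  have h0 : coeff 0 f = 1 := by simpa using hf.1
  refine ⟨by rw [← coeff_zero_eq_constantCoeff_apply, coeff_rescale, h0, pow_zero, one_mul], ?_⟩
  rw [← map_mul, ← hf.2]
  ext n
  rw [coeff_X_mul_derivative, coeff_rescale, coeff_rescale, coeff_X_mul_derivative]
  ring

theorem expand {m : ℕ} (hm : m ≠ 0) (hf : IsLogExp Q f) :
    IsLogExp (C (m : R) * PowerSeries.expand m hm Q) (PowerSeries.expand m hm f) := by
  refine ⟨by simpa using hf.1, ?_⟩
  rw [mul_assoc, ← map_mul, ← hf.2]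
  ext n
  rw [coeff_X_mul_derivative, coeff_C_mul, coeff_expand, coeff_expand]
  split_ifs with h
  · obtain ⟨k, rfl⟩ := h
    rw [Nat.mul_div_cancel_left _ (Nat.pos_of_ne_zero hm), coeff_X_mul_derivative]
    push_cast
    ring
  · simp

/-- A series is determined up to order `N` by its logarithmic derivative up to order `N`. -/
theorem coeff_eq [IsAddTorsionFree R] (hf : IsLogExp Q f) (hg : IsLogExp Q' g)
    (hQ : constantCoeff Q = 0) {N : ℕ} (h : ∀ n ≤ N, coeff n Q = coeff n Q') :
    ∀ n ≤ N, coeff n f = coeff n g := by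
  intro n
  induction n using Nat.strong_induction_on with
  | _ n ih =>
    intro hn
    rcases Nat.eq_zero_or_pos n with rfl | hpos
    · simp [hf.1, hg.1]
    -- Torsion-freeness allows division by `n` in the recursion `n f_n = ∑ Q_i f_{n-i}`.
    · refine nsmul_right_injective hpos.ne' ?_
      simp only [nsmul_eq_mul]
      rw [hf.coeff_mul, hg.coeff_mul]
      refine sum_congr rfl fun x hx => ?_
      rw [HasAntidiagonal.mem_antidiagonal] at hx
      rw [← h x.1 (by omega)]
      rcases Nat.eq_zero_or_pos x.1 with h0 | h0
      · simp [h0, hQ]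
      · rw [ih x.2 (by omega) (by omega)]

theorem eq [IsAddTorsionFree R] (hf : IsLogExp Q f) (hg : IsLogExp Q g)
    (hQ : constantCoeff Q = 0) : f = g := by
  ext n
  exact hf.coeff_eq hg hQ (N := n) (fun _ _ => rfl) n le_rfl

/-- The logarithmic derivative is determined up to order `N` by the series up to order `N`. -/
theorem coeff_logDeriv_eq (hf : IsLogExp Q f) (hg : IsLogExp Q' g) {N : ℕ}
    (h : ∀ n ≤ N, coeff n f = coeff n g) : ∀ n ≤ N, coeff n Q = coeff n Q' := by
  intro n
  induction n using Nat.strong_induction_on with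
  | _ n ih =>
    intro hn
    have h1 := hf.coeff_mul n
    have h2 := hg.coeff_mul n
    rw [h n hn, h2, Nat.sum_antidiagonal_eq_sum_range_succ_mk,
      Nat.sum_antidiagonal_eq_sum_range_succ_mk, sum_range_succ, sum_range_succ] at h1
    have h3 : ∑ k ∈ range n, coeff k Q * coeff (n - k) f =
        ∑ k ∈ range n, coeff k Q' * coeff (n - k) g := by
      refine sum_congr rfl fun k hk => ?_
      rw [mem_range] at hk
      rw [ih k hk (by omega), h _ (by omega)]
    have hf0 : coeff 0 f = 1 := by simpa using hf.1
    have hg0 : coeff 0 g = 1 := by simpa using hg.1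
    simp only [h3, Nat.sub_self, hf0, hg0, mul_one] at h1
    exact (add_left_cancel h1).symm

end IsLogExp

/-- The series `∑ (-1)^(r-1) p_r X^r`; it is meant for `p 0 = 0`. -/
def powerSumSeries (p : ℕ → R) : R⟦X⟧ := PowerSeries.mk fun r => (-1) ^ (r - 1) * p r

theorem coeff_powerSumSeries (p : ℕ → R) (r : ℕ) :
    coeff r (powerSumSeries p) = (-1) ^ (r - 1) * p r := coeff_mk _ _

theorem isLogExp_one_add_X :
    IsLogExp (powerSumSeries fun r => if r = 0 then 0 else 1) (1 + X : R⟦X⟧) := by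
  refine ⟨by simp, ?_⟩
  ext n
  rw [coeff_X_mul_derivative, mul_add, mul_one, map_add, map_add]
  rcases n with _ | _ | n
  · simp [coeff_powerSumSeries]
  · simp [coeff_powerSumSeries, coeff_one]
  · rw [coeff_succ_mul_X]
    simp [coeff_powerSumSeries, coeff_one, coeff_X, pow_succ]

/-- Every power series with constant term `1` agrees up to order `N` with a finite product of
factors `1 + w_m X^m`. -/
theorem exists_coeff_eq_prod (f : R⟦X⟧) (hf : constantCoeff f = 1) (N : ℕ) :
    ∃ (T : Finset ℕ+) (w : ℕ+ → R), (∀ m ∈ T, (m : ℕ) ≤ N) ∧ ∀ n ≤ N,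
      coeff n f = coeff n (∏ m ∈ T, (1 + C (w m) * X ^ (m : ℕ))) := by
  induction N with
  | zero => exact ⟨∅, 0, by simp, fun n hn => by obtain rfl := Nat.le_zero.1 hn; simp [hf]⟩
  | succ N ih =>
    obtain ⟨T, w, hT, hw⟩ := ih
    set P := ∏ m ∈ T, (1 + C (w m) * X ^ (m : ℕ)) with hP
    have hP0 : constantCoeff P = 1 := by
      rw [hP, map_prod]
      exact prod_eq_one fun m _ => by simp
    have hN : N.succPNat ∉ T := fun h => by
      have := hT _ h
      rw [Nat.succPNat_coe] at this
      omega
    -- Since `P` has constant term `1`, the new factor adds exactly its parameter to the coefficient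
    -- of `X^(N+1)` and changes nothing below.
    refine ⟨insert N.succPNat T,
      Function.update w N.succPNat (coeff (N + 1) f - coeff (N + 1) P), ?_, fun n hn => ?_⟩
    · intro m hm
      rcases Finset.mem_insert.1 hm with rfl | hm
      · simp
      · exact (hT m hm).trans (Nat.le_succ N)
    have hprod : ∏ m ∈ T, (1 + C (Function.update w N.succPNat
        (coeff (N + 1) f - coeff (N + 1) P) m) * X ^ (m : ℕ)) = P := by
      refine prod_congr rfl fun m hm => ?_
      rw [Function.update_of_ne (ne_of_mem_of_not_mem hm hN)]
    rw [prod_insert hN, hprod, Function.update_self, Nat.succPNat_coe, mul_comm, mul_add, mul_one,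
      map_add, mul_left_comm, coeff_C_mul]
    rcases Nat.lt_or_ge n (N + 1) with h | h
    · rw [hw n (by omega), coeff_mul_X_pow', if_neg (by omega)]
      simp
    · obtain rfl : n = N + 1 := by omega
      rw [coeff_mul_X_pow', if_pos le_rfl]
      simp [hP0]

end LogDerivative

/-! ### Logarithmic derivatives of the three generating series. -/

section HatSeries

open PowerSeries

/-- The variable `h_r` for `r > 0`, and `0` for `r = 0`. -/
def hN (r : ℕ) : QH := if hr : 0 < r then h (r.toPNat hr) else 0

theorem hN_zero : hN 0 = 0 := by simp [hN]

theorem hN_coe (r : ℕ+) : hN r = h r := by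
  rw [hN, dif_pos r.pos]
  rfl

theorem lam_hN (m : ℕ+) (r : ℕ) : lam m (hN r) = hN (m * r) := by
  rcases Nat.eq_zero_or_pos r with rfl | hr
  · simp [hN_zero]
  · obtain ⟨r, rfl⟩ : ∃ s : ℕ+, (s : ℕ) = r := ⟨⟨r, hr⟩, rfl⟩
    rw [hN_coe, ← PNat.mul_coe, hN_coe]
    simp [lam, h]

theorem isLogExp_exp_subst (g : PowerSeries QH) (hg : HasSubst g) (hg0 : constantCoeff g = 0) :
    IsLogExp (X * derivative QH g) ((PowerSeries.exp ℚ).subst g) := by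
  have h1 : (PowerSeries.exp ℚ).subst g = (PowerSeries.exp QH).subst g := by
    ext n
    rw [coeff_subst' hg, coeff_subst' hg]
    congr 1
    ext1 d
    simp [coeff_exp, Algebra.smul_def]
  rw [h1]
  constructor
  · rw [← coeff_zero_eq_constantCoeff_apply, coeff_subst' hg, finsum_eq_single _ 0]
    · simp
    · intro n hn
      rw [coeff_zero_eq_constantCoeff_apply, map_pow, hg0, zero_pow hn, smul_zero]
  · rw [derivative_subst hg, derivative_exp]
    ring

theorem isLogExp_hatSeries (a : ℕ+ → ℚ) (b : ℕ → ℚ) (hb : ∀ r : ℕ+, b r = a r) :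
    IsLogExp (powerSumSeries fun r => b r • hN r) (hatSeries a) := by
  rw [hatSeries]
  convert isLogExp_exp_subst (logSeries a) (hasSubst_logSeries a) (constantCoeff_logSeries a)
  ext1 n
  rw [coeff_X_mul_derivative, coeff_powerSumSeries, logSeries, coeff_mk]
  split_ifs with hn
  · obtain ⟨r, rfl⟩ : ∃ s : ℕ+, (s : ℕ) = n := ⟨⟨n, hn⟩, rfl⟩
    have hr : ((r : ℕ) : ℚ) ≠ 0 := by exact_mod_cast r.ne_zero
    have hto : (r : ℕ).toPNat hn = r := rfl
    simp only [hto, hN_coe, hb]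
    rw [← nsmul_eq_mul, ← Nat.cast_smul_eq_nsmul ℚ, smul_smul, mul_div_cancel₀ _ hr, mul_smul]
    simp only [MvPolynomial.smul_eq_C_mul, map_pow, map_neg, map_one]
  · obtain rfl : n = 0 := by omega
    simp [hN_zero]

theorem isLogExp_hHat : IsLogExp (powerSumSeries hN) (hatSeries fun _ => 1) := by
  simpa using isLogExp_hatSeries (fun _ => 1) (fun _ => 1) (fun _ => rfl)

theorem isLogExp_hCheck :
    IsLogExp (powerSumSeries fun r => (1 / 2 : ℚ) • hN r) (hatSeries fun _ => 1 / 2) :=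
  isLogExp_hatSeries (fun _ => 1 / 2) (fun _ => 1 / 2) (fun _ => rfl)

theorem isLogExp_hBar :
    IsLogExp (powerSumSeries fun r => (if Even r then (1 : ℚ) else 0) • hN r)
      (hatSeries fun r => 1 / 2 * multSeq 2 r) := by
  refine isLogExp_hatSeries _ _ fun r => ?_
  by_cases h2 : (2 : ℕ) ∣ r
  · simp [multSeq, h2, even_iff_two_dvd]
  · simp [multSeq, h2, even_iff_two_dvd]

end HatSeries

/-- The element `∏_{m > 0} λ_m(ĥ_{k_m})`. -/
def hatProd (k : ℕ+ →₀ ℕ) : QH := k.prod fun m n => lam m (hHat n)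

/-- The `ℤ`-linear span of the elements `∏_{m > 0} λ_m(ĥ_{k_m})`. -/
def hatSpan : Submodule ℤ QH := Submodule.span ℤ (Set.range hatProd)

/-- The `ℤ`-subalgebra generated by all `ĥ_r`. -/
def hatAlgebra : Subalgebra ℤ QH := Algebra.adjoin ℤ (Set.range hHat)

theorem hHat_zero : hHat 0 = 1 := hatCoeff_zero _

theorem prod_lam_hHat_mem_hatSpan (T : Finset ℕ+) (s : ℕ+ → ℕ) :
    ∏ m ∈ T, lam m (hHat (s m)) ∈ hatSpan := by
  refine Submodule.subset_span ⟨Finsupp.indicator T fun m _ => s m, ?_⟩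
  rw [hatProd, Finsupp.prod_indicator_index_eq_prod_attach]
  · exact prod_attach T fun m => lam m (hHat (s m))
  · intro m _
    rw [hHat_zero, map_one]

/-! ### Products of the `ĥ_k` as integral combinations of the `∏ λ_m(ĥ_{k_m})`. -/

section Factorization

open PowerSeries

theorem one_add_eq_expand {R : Type*} [CommRing R] (m : ℕ+) (c : R) :
    (1 + C c * X ^ (m : ℕ) : R⟦X⟧) = expand m m.ne_zero (rescale c (1 + X)) := by
  rw [map_add, map_one, rescale_X, map_add, map_one, map_mul, expand_C, expand_X]

/-- Only `p (r / m) = q r` enters the `r`-th coefficient, so `q r` factors out. The scalar left over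
is independent of `p`; this is what transfers an identity for `1 + X` to `Ĥ`. -/
theorem coeff_expand_rescale_powerSumSeries {R : Type*} [CommRing R] (m : ℕ+) (c : R)
    (p q : ℕ → R) (hp : p 0 = 0) (hpq : ∀ r, p r = q (m * r)) (r : ℕ) :
    coeff r (C ((m : ℕ) : R) * expand m m.ne_zero (rescale c (powerSumSeries p))) =
      q r * coeff r (C ((m : ℕ) : R) * expand m m.ne_zero
        (rescale c (powerSumSeries fun r => if r = 0 then 0 else 1))) := by
  rw [coeff_C_mul, coeff_C_mul, coeff_expand, coeff_expand]
  split_ifs with h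
  · obtain ⟨s, rfl⟩ := h
    rw [Nat.mul_div_cancel_left _ m.pos, coeff_rescale, coeff_rescale, coeff_powerSumSeries,
      coeff_powerSumSeries, hpq]
    split_ifs with hs
    · subst hs
      rw [← hpq, hp]
      ring
    · ring
  · simp

theorem map_powerSumSeries {R S : Type*} [CommRing R] [CommRing S] (φ : R →+* S) (p : ℕ → R) :
    map φ (powerSumSeries p) = powerSumSeries fun r => φ (p r) := by
  ext n
  simp [coeff_powerSumSeries]

theorem prod_hHat_mem_hatSpan {n : ℕ} (a : Fin n → ℕ) : ∏ i, hHat (a i) ∈ hatSpan := by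
  classical
  let φ : MvPolynomial (Fin n) ℤ →+* MvPolynomial (Fin n) QH :=
    MvPolynomial.map (Int.castRingHom QH)
  have hC : ∀ j : Fin n, φ (MvPolynomial.X j) = MvPolynomial.X j := fun j => by simp [φ]
  set N := ∑ i, a i with hN'
  have hf : IsLogExp _ (∏ j : Fin n, rescale (MvPolynomial.X j : MvPolynomial (Fin n) ℤ)
    (1 + X)) := IsLogExp.prod _ fun j _ => isLogExp_one_add_X.rescale (MvPolynomial.X j)
  -- The factorization is done over `ℤ[x]`, so the `w_m` have integer coefficients; this is the
  -- source of integrality.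
  obtain ⟨T, w, -, hw⟩ := exists_coeff_eq_prod _ hf.1 N
  have hg : IsLogExp _ (∏ m ∈ T, (1 + C (w m) * X ^ (m : ℕ))) :=
    IsLogExp.prod _ fun m _ => by
      rw [one_add_eq_expand]
      exact (isLogExp_one_add_X.rescale (w m)).expand m.ne_zero
  have hfg := fun r hr => congrArg φ (hf.coeff_logDeriv_eq hg hw r hr)
  have hF : IsLogExp _ (∏ j : Fin n, rescale (φ (MvPolynomial.X j))
      (map MvPolynomial.C (hatSeries fun _ => 1))) :=
    IsLogExp.prod _ fun j _ => (isLogExp_hHat.map _).rescale _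
  have hG : IsLogExp _ (∏ m ∈ T, expand m m.ne_zero (rescale (φ (w m))
      (map ((MvPolynomial.C : QH →+* MvPolynomial (Fin n) QH).comp (lam m : QH →+* QH))
        (hatSeries fun _ => 1)))) :=
    IsLogExp.prod _ fun m _ => ((isLogExp_hHat.map _).rescale _).expand m.ne_zero
  have hQ0 : constantCoeff (∑ j : Fin n, rescale (φ (MvPolynomial.X j))
      (map MvPolynomial.C (powerSumSeries hN))) = 0 := by
    rw [map_sum]
    refine sum_eq_zero fun j _ => ?_
    rw [← coeff_zero_eq_constantCoeff_apply, coeff_rescale, coeff_map, coeff_powerSumSeries,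
      hN_zero]
    simp
  -- Both logarithmic derivatives have `r`-th coefficient `h_r` times the corresponding coefficient
  -- for `1 + X`.
  have key := hF.coeff_eq hG hQ0 (N := N) (fun r hr => by
    have h1 := hfg r hr
    have hone : ∀ r : ℕ, φ (if r = 0 then 0 else 1) = if r = 0 then 0 else 1 := fun r => by
      split_ifs <;> simp
    calc _ = MvPolynomial.C (hN r) * φ (coeff r (∑ j : Fin n,
            rescale (MvPolynomial.X j : MvPolynomial (Fin n) ℤ)
              (powerSumSeries fun r => if r = 0 then 0 else 1))) := by
          rw [map_sum, map_sum, map_sum, mul_sum]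
          refine sum_congr rfl fun j _ => ?_
          rw [coeff_rescale, coeff_rescale, coeff_map, coeff_powerSumSeries,
            coeff_powerSumSeries]
          rcases Nat.eq_zero_or_pos r with rfl | hr
          · simp [hN_zero]
          · simp only [hr.ne', if_false, map_mul, map_pow, map_neg, map_one]
            ring
      _ = _ := by
          rw [h1, map_sum, map_sum, map_sum, mul_sum]
          refine sum_congr rfl fun m _ => ?_
          rw [map_powerSumSeries, coeff_expand_rescale_powerSumSeries m _ _
            (fun r => MvPolynomial.C (hN r)) (by simp [hN_zero]) (fun r => by simp [lam_hN]),
            ← coeff_map]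
          congr 2
          rw [map_mul, map_C, map_natCast, map_expand, ← rescale_map, map_powerSumSeries]
          simp only [hone]) N le_rfl
  -- In degree `N = ∑ a_i`, the monomial `x^a` on the left has coefficient exactly `∏ ĥ_{a_i}`.
  have hcoeff := congrArg (MvPolynomial.coeff (Finsupp.equivFunOnFinite.symm a)) key
  have hmem : Finsupp.equivFunOnFinite.symm a ∈ finsuppAntidiag univ N := by
    simp [mem_finsuppAntidiag, hN']
  have hleft : ∀ l : Fin n →₀ ℕ, ∏ j, coeff (l j) (rescale (φ (MvPolynomial.X j))
      (map MvPolynomial.C (hatSeries fun _ => 1))) =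
      MvPolynomial.monomial l (∏ j, hHat (l j)) := by
    intro l
    simp only [coeff_rescale, coeff_map, hC]
    rw [prod_mul_distrib, MvPolynomial.monomial_eq, Finsupp.prod_fintype _ _ (by simp), map_prod,
      mul_comm]
    rfl
  rw [coeff_prod, coeff_prod, MvPolynomial.coeff_sum, MvPolynomial.coeff_sum,
    sum_congr rfl fun l _ => by rw [hleft, MvPolynomial.coeff_monomial],
    sum_ite_eq' _ _ _, if_pos hmem] at hcoeff
  have : ∏ i, hHat (a i) = ∏ i, hHat (Finsupp.equivFunOnFinite.symm a i) := by simp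
  rw [this, hcoeff]
  refine Submodule.sum_mem _ fun l _ => ?_
  by_cases hl : ∀ m ∈ T, (m : ℕ) ∣ l m
  · have hterm : ∏ m ∈ T, coeff (l m) (expand m m.ne_zero (rescale (φ (w m))
        (map ((MvPolynomial.C : QH →+* MvPolynomial (Fin n) QH).comp (lam m : QH →+* QH))
          (hatSeries fun _ => 1)))) =
        MvPolynomial.C (∏ m ∈ T, lam m (hHat (l m / m))) *
          φ (∏ m ∈ T, w m ^ (l m / m)) := by
      rw [map_prod, map_prod, ← prod_mul_distrib]
      refine prod_congr rfl fun m hm => ?_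
      rw [coeff_expand, if_pos (hl m hm), coeff_rescale, coeff_map, map_pow, mul_comm]
      rfl
    rw [hterm, MvPolynomial.coeff_C_mul, MvPolynomial.coeff_map, mul_comm, eq_intCast,
      ← zsmul_eq_mul]
    exact Submodule.smul_mem _ _ (prod_lam_hHat_mem_hatSpan T _)
  · push Not at hl
    obtain ⟨m, hm, hml⟩ := hl
    rw [prod_eq_zero hm, MvPolynomial.coeff_zero]
    · exact Submodule.zero_mem _
    · rw [coeff_expand, if_neg hml]

theorem hatAlgebra_le_hatSpan : Subalgebra.toSubmodule hatAlgebra ≤ hatSpan := by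
  rw [hatAlgebra, Algebra.adjoin_eq_span, Submodule.span_le]
  intro x hx
  obtain ⟨l, hl, rfl⟩ := Submonoid.exists_list_of_mem_closure hx
  choose a ha using fun i : Fin l.length => hl (l.get i) (l.get_mem i)
  have : l.prod = ∏ i, hHat (a i) := by
    simp only [ha]
    exact (Fin.prod_univ_getElem l).symm
  rw [this]
  exact prod_hHat_mem_hatSpan a

end Factorization

/-! ### Adjoining a formal root of unity. -/

section RootsOfUnity

/-- An integer polynomial vanishing at a primitive complex root is a multiple of the cyclotomic
polynomial, hence vanishes at the formal root too. The relations are therefore checked in `ℂ`, and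
the quotient ring need not be a domain. -/
theorem sum_pow_root_cyclotomic {R : Type*} [CommRing R] (m : ℕ) (hm : 0 < m) (r : ℕ) :
    ∑ j ∈ range m, (AdjoinRoot.root (Polynomial.cyclotomic m R) ^ j) ^ r =
      if m ∣ r then (m : AdjoinRoot (Polynomial.cyclotomic m R)) else 0 := by
  set ζ := AdjoinRoot.root (Polynomial.cyclotomic m R)
  let ξ := Complex.exp (2 * Real.pi * Complex.I / m)
  have hξ : IsPrimitiveRoot ξ m := Complex.isPrimitiveRoot_exp m hm.ne'
  have hdvd : ∀ p : Polynomial ℤ, Polynomial.aeval ξ p = 0 → Polynomial.aeval ζ p = 0 := by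
    intro p hp
    have h1 := minpoly.isIntegrallyClosed_dvd (hξ.isIntegral hm) hp
    rw [← Polynomial.cyclotomic_eq_minpoly hξ hm] at h1
    obtain ⟨q, rfl⟩ := h1
    rw [map_mul]
    have : Polynomial.aeval ζ (Polynomial.cyclotomic m ℤ) = 0 := by
      have h2 := AdjoinRoot.eval₂_root (Polynomial.cyclotomic m R)
      rw [Polynomial.eval₂_eq_eval_map, Polynomial.map_cyclotomic] at h2
      rw [Polynomial.aeval_def, Polynomial.eval₂_eq_eval_map, Polynomial.map_cyclotomic]
      exact h2
    rw [this, zero_mul]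
  have hζ : ζ ^ m = 1 := by
    have := hdvd (Polynomial.X ^ m - 1) (by simp [hξ.pow_eq_one])
    simpa [sub_eq_zero] using this
  split_ifs with h
  · obtain ⟨s, rfl⟩ := h
    have : ∀ j ∈ range m, (ζ ^ j) ^ (m * s) = 1 := fun j _ => by
      rw [← pow_mul, mul_left_comm, pow_mul, hζ, one_pow]
    rw [sum_congr rfl this]
    simp
  · have h0 : ∑ j ∈ range m, (ξ ^ j) ^ r = 0 := by
      have hne : ξ ^ r - 1 ≠ 0 := fun h1 => h ((hξ.pow_eq_one_iff_dvd r).1 (sub_eq_zero.1 h1))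
      refine (mul_eq_zero.1 ?_).resolve_right hne
      simp_rw [pow_right_comm ξ _ r]
      rw [geom_sum_mul, pow_right_comm, hξ.pow_eq_one, one_pow, sub_self]
    have := hdvd (∑ j ∈ range m, (Polynomial.X ^ j) ^ r) (by simpa using h0)
    simpa using this

/-- A linear form on `R[ζ]` that fixes `1` and is integral on the powers of `ζ`. -/
theorem exists_linearMap_root_pow {R : Type*} [CommRing R] [Nontrivial R] (g : Polynomial ℤ)
    (hg : g.Monic) (hdeg : 0 < g.natDegree) :
    ∃ π : AdjoinRoot (g.map (Int.castRingHom R)) →ₗ[R] R, π 1 = 1 ∧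
      ∀ e : ℕ, ∃ z : ℤ, π (AdjoinRoot.root _ ^ e) = z := by
  have hg' := hg.map (Int.castRingHom R)
  refine ⟨Polynomial.lcoeff R 0 ∘ₗ AdjoinRoot.modByMonicHom hg', ?_, fun e => ?_⟩
  · have : (1 : AdjoinRoot (g.map (Int.castRingHom R))) = AdjoinRoot.mk _ 1 := (map_one _).symm
    rw [LinearMap.comp_apply, this, AdjoinRoot.modByMonicHom_mk,
      (Polynomial.modByMonic_eq_self_iff hg').2]
    · simp
    · rw [Polynomial.degree_one, ← Polynomial.natDegree_pos_iff_degree_pos, hg.natDegree_map]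
      exact hdeg
  -- As `g` is monic over `ℤ`, the remainder of `X^e` is already computed over `ℤ`.
  · refine ⟨(Polynomial.X ^ e %ₘ g).coeff 0, ?_⟩
    rw [LinearMap.comp_apply, ← AdjoinRoot.mk_X, ← map_pow, AdjoinRoot.modByMonicHom_mk]
    have : (Polynomial.X ^ e : Polynomial R) =
        (Polynomial.X ^ e : Polynomial ℤ).map (Int.castRingHom R) := by simp
    rw [this, ← Polynomial.map_modByMonic _ hg]
    simp

end RootsOfUnity

/-! ### Stability of the algebra of the `ĥ_k` under `λ_m`. -/

section Frobenius

open PowerSeries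

theorem hHat_mem_hatAlgebra (k : ℕ) : hHat k ∈ hatAlgebra :=
  Algebra.subset_adjoin ⟨k, rfl⟩

/-- Averaging over roots of unity kills the `h_r` with `m ∤ r`, so `∏_j Ĥ(ζ^j u)` is `λ_m Ĥ` in `±
u^m`. A linear form integral on powers of `ζ` brings the coefficients back to the algebra. -/
theorem lam_hHat_mem_hatAlgebra (m : ℕ+) (k : ℕ) : lam m (hHat k) ∈ hatAlgebra := by
  classical
  have hex := exists_linearMap_root_pow (R := QH) (Polynomial.cyclotomic m ℤ)
    (Polynomial.cyclotomic.monic _ _)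
    (by rw [Polynomial.natDegree_cyclotomic]; exact Nat.totient_pos.2 m.pos)
  have hsum := sum_pow_root_cyclotomic (R := QH) m m.pos
  rw [← Polynomial.map_cyclotomic_int] at hsum
  -- From here on, only the linear form and the power sums of the root matter.
  generalize (Polynomial.cyclotomic m ℤ).map (Int.castRingHom QH) = g at hex hsum
  obtain ⟨π, hπ1, hπ⟩ := hex
  set ζ := AdjoinRoot.root g with hζ
  have : IsAddTorsionFree (AdjoinRoot g) := IsAddTorsionFree.of_module_rat _
  -- This sign reconciles `(-1)^(ms-1)` with `(-1)^(s-1)`: the first is `c^s` times the second.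
  set c : AdjoinRoot g := (-1) ^ ((m : ℕ) - 1) with hc
  have hF : IsLogExp _ (∏ j ∈ range m, rescale (ζ ^ j)
      (map (AdjoinRoot.of g) (hatSeries fun _ => 1))) :=
    IsLogExp.prod _ fun j _ => (isLogExp_hHat.map _).rescale _
  have hG : IsLogExp _ (expand m m.ne_zero (rescale c
      (map ((AdjoinRoot.of g).comp (lam m : QH →+* QH)) (hatSeries fun _ => 1)))) :=
    ((isLogExp_hHat.map _).rescale _).expand m.ne_zero
  have key := congrArg (coeff (m * k)) (hF.eq (g := expand m m.ne_zero (rescale c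
      (map ((AdjoinRoot.of g).comp (lam m : QH →+* QH)) (hatSeries fun _ => 1)))) (by
    convert hG using 1
    ext r
    rw [map_sum, coeff_C_mul, coeff_expand]
    simp only [coeff_rescale, coeff_map, coeff_powerSumSeries]
    rw [← sum_mul, hsum]
    split_ifs with h
    · obtain ⟨s, rfl⟩ := h
      rw [Nat.mul_div_cancel_left _ m.pos]
      rcases Nat.eq_zero_or_pos s with rfl | hs
      · simp [hN_zero]
      · have hsign : ((-1) ^ ((m : ℕ) * s - 1) : AdjoinRoot g) = c ^ s * (-1) ^ (s - 1) := by
          rw [hc, ← pow_mul, ← pow_add]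
          congr 1
          obtain ⟨a, ha⟩ : ∃ a, (m : ℕ) = a + 1 := ⟨m - 1, by have := m.pos; omega⟩
          obtain ⟨b, rfl⟩ : ∃ b, s = b + 1 := ⟨s - 1, by omega⟩
          rw [ha]
          simp only [Nat.add_sub_cancel]
          have : (a + 1) * (b + 1) = a * (b + 1) + b + 1 := by ring
          omega
        simp only [map_mul, map_pow, map_neg, map_one, RingHom.comp_apply, RingHom.coe_coe,
          lam_hN, hsign]
        ring
    · simp) (by
    rw [map_sum]
    refine sum_eq_zero fun j _ => ?_
    rw [← coeff_zero_eq_constantCoeff_apply, coeff_rescale, coeff_map, coeff_powerSumSeries,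
      hN_zero]
    simp))
  rw [coeff_expand_mul, coeff_rescale, coeff_map, coeff_prod] at key
  have hof : ∀ (x : QH) (y : AdjoinRoot g), π (AdjoinRoot.of g x * y) = x * π y := fun x y => by
    rw [← AdjoinRoot.algebraMap_eq, ← Algebra.smul_def, map_smul, smul_eq_mul]
  have hsgn : c ^ k * ((AdjoinRoot.of g).comp (lam m : QH →+* QH)) (coeff k (hatSeries fun _ => 1))
      = AdjoinRoot.of g (((-1) ^ ((m : ℕ) - 1)) ^ k * lam m (hHat k)) * 1 := by
    simp only [map_mul, map_pow, map_neg, map_one, mul_one]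
    rfl
  have key2 := congrArg π key
  rw [hsgn, hof, hπ1, mul_one, map_sum] at key2
  have hmem : ((-1) ^ ((m : ℕ) - 1)) ^ k * lam m (hHat k) ∈ hatAlgebra := by
    rw [← key2]
    refine Subalgebra.sum_mem _ fun l _ => ?_
    have : ∏ i ∈ range m, coeff (l i) (rescale (ζ ^ i)
        (map (AdjoinRoot.of g) (hatSeries fun _ => 1))) =
        AdjoinRoot.of g (∏ i ∈ range m, hHat (l i)) * ζ ^ ∑ i ∈ range m, i * l i := by
      simp only [coeff_rescale, coeff_map]
      rw [prod_mul_distrib, map_prod, mul_comm, ← prod_pow_eq_pow_sum]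
      simp only [pow_mul]
      rfl
    rw [this, hof]
    obtain ⟨z, hz⟩ := hπ (∑ i ∈ range m, i * l i)
    rw [hz, mul_comm, ← zsmul_eq_mul]
    exact Subalgebra.smul_mem _ (Subalgebra.prod_mem _ fun i _ => hHat_mem_hatAlgebra _) _
  have hpm : ((-1 : QH) ^ ((m : ℕ) - 1)) ^ k * ((-1) ^ ((m : ℕ) - 1)) ^ k = 1 := by
    rw [← mul_pow, ← mul_pow]; simp
  have hone : ((-1 : QH) ^ ((m : ℕ) - 1)) ^ k ∈ hatAlgebra :=
    pow_mem (pow_mem (neg_mem (one_mem _)) _) _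
  have := mul_mem hone hmem
  rwa [← mul_assoc, hpm, one_mul] at this

theorem hatAlgebra_eq_hatSpan : Subalgebra.toSubmodule hatAlgebra = hatSpan := by
  refine le_antisymm hatAlgebra_le_hatSpan ?_
  rw [hatSpan, Submodule.span_le]
  rintro _ ⟨k, rfl⟩
  exact Subalgebra.prod_mem _ fun m _ => lam_hHat_mem_hatAlgebra m _

end Frobenius

/-! ### The algebra `ℤ[h̄_{2k}]` as an image under halving. -/

section Halving

open PowerSeries

/-- The algebra endomorphism `h_r ↦ h_{2r} / 2`, which sends `ĥ_k` to `λ_2(ȟ_k)`. -/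
def halfLam : QH →ₐ[ℚ] QH := MvPolynomial.aeval fun r => (1 / 2 : ℚ) • h (2 * r)

theorem halfLam_hN (r : ℕ) : halfLam (hN r) = (1 / 2 : ℚ) • hN (2 * r) := by
  rcases Nat.eq_zero_or_pos r with rfl | hr
  · simp [hN_zero]
  · obtain ⟨r, rfl⟩ : ∃ s : ℕ+, (s : ℕ) = r := ⟨⟨r, hr⟩, rfl⟩
    have h2 : 2 * (r : ℕ) = ((2 * r : ℕ+) : ℕ) := by simp
    rw [h2, hN_coe, hN_coe]
    simp [halfLam, h]

theorem constantCoeff_map_powerSumSeries_hN (φ : QH →+* QH) :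
    constantCoeff (map φ (powerSumSeries hN)) = 0 := by
  rw [← coeff_zero_eq_constantCoeff_apply, coeff_map, coeff_powerSumSeries, hN_zero]
  simp

theorem halfLam_lam_hHat (m : ℕ+) (k : ℕ) :
    halfLam (lam m (hHat k)) = lam (2 * m) (hCheck k) := by
  have h1 : IsLogExp (map ((halfLam : QH →+* QH).comp (lam m : QH →+* QH)) (powerSumSeries hN)) _ :=
    isLogExp_hHat.map _
  have h2 : IsLogExp (map (lam (2 * m) : QH →+* QH) _) _ := isLogExp_hCheck.map _
  refine congrArg (coeff k) (h1.eq (g := map (lam (2 * m) : QH →+* QH) (hatSeries fun _ => 1 / 2))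
    ?_ (constantCoeff_map_powerSumSeries_hN _))
  convert h2 using 1
  rw [map_powerSumSeries, map_powerSumSeries]
  congr 1
  ext1 r
  simp only [RingHom.comp_apply, RingHom.coe_coe, lam_hN, halfLam_hN, map_smul, PNat.mul_coe,
    PNat.val_ofNat, mul_assoc]

/-- The series is the square of its halved version, since `exp(L) = exp(L/2)²`. -/
theorem lam_two_mul_hHat (m : ℕ+) (k : ℕ) :
    lam (2 * m) (hHat k) =
      ∑ x ∈ antidiagonal k, halfLam (lam m (hHat x.1)) * halfLam (lam m (hHat x.2)) := by
  have h1 : IsLogExp (map ((halfLam : QH →+* QH).comp (lam m : QH →+* QH)) (powerSumSeries hN)) _ :=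
    isLogExp_hHat.map _
  have h2 : IsLogExp (map (lam (2 * m) : QH →+* QH) (powerSumSeries hN)) _ := isLogExp_hHat.map _
  have := congrArg (coeff k) (h2.eq (g := _ * _) (by
    convert h1.mul h1 using 1
    ext r
    rw [map_add, coeff_map, coeff_map, coeff_powerSumSeries]
    simp only [map_mul, map_pow, map_neg, map_one, RingHom.comp_apply, RingHom.coe_coe, lam_hN,
      halfLam_hN, PNat.mul_coe, PNat.val_ofNat, mul_assoc]
    rw [← mul_add, ← add_smul]
    norm_num) (constantCoeff_map_powerSumSeries_hN _))
  rw [coeff_map, coeff_mul] at this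
  exact this

/-- Only even indices `r = 2s` contribute; the sign comes from `(-1)^(2s-1) = (-1)^s (-1)^(s-1)`,
that is, from replacing `u` by `-u²`. -/
theorem hBar_eq (n : ℕ) :
    hBar n = if 2 ∣ n then (-1) ^ (n / 2) * halfLam (hHat (n / 2)) else 0 := by
  have h1 : IsLogExp _ (expand 2 two_ne_zero (rescale (-1) (map (halfLam : QH →+* QH) _))) :=
    ((isLogExp_hHat.map (halfLam : QH →+* QH)).rescale (-1)).expand two_ne_zero
  have := congrArg (coeff n) (isLogExp_hBar.eq (g := expand 2 two_ne_zero
      (rescale (-1) (map (halfLam : QH →+* QH) (hatSeries fun _ => 1)))) (by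
    convert h1 using 1
    ext1 r
    rw [coeff_C_mul, coeff_expand, coeff_powerSumSeries]
    split_ifs with h2 h3 h3
    · obtain ⟨s, rfl⟩ := h3
      rw [Nat.mul_div_cancel_left _ two_pos, coeff_rescale, coeff_map, coeff_powerSumSeries]
      rcases s with _ | s
      · simp [hN_zero]
      · simp only [map_mul, map_pow, map_neg, map_one, RingHom.coe_coe, halfLam_hN]
        have h4 : (-1 : QH) ^ (2 * (s + 1) - 1) = (-1) ^ (s + 1) * (-1) ^ (s + 1 - 1) := by
          rw [← pow_add]
          congr 1
          omega
        rw [h4, mul_smul_comm, mul_smul_comm, one_smul, Nat.cast_ofNat, ← mul_smul_comm,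
          MvPolynomial.smul_eq_C_mul]
        have h5 : (2 : QH) * MvPolynomial.C (1 / 2 : ℚ) = 1 := by
          rw [← map_ofNat MvPolynomial.C 2, ← map_mul]
          norm_num
        linear_combination (-(-1 : QH) ^ (s + 1) * (-1) ^ (s + 1 - 1) * hN (2 * (s + 1))) * h5
    · exact absurd (even_iff_two_dvd.1 h2) h3
    · exact absurd (even_iff_two_dvd.2 h3) h2
    · simp) (by
    rw [← coeff_zero_eq_constantCoeff_apply, coeff_powerSumSeries, hN_zero]
    simp))
  rw [coeff_expand] at this
  rw [hBar, hatCoeff, this]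
  split_ifs
  · rw [coeff_rescale, coeff_map]
    rfl
  · rfl

theorem hHat_mem_mixedAlgebra (k : ℕ) : hHat k ∈ mixedAlgebra := by
  rcases Nat.eq_zero_or_pos k with rfl | hk
  · rw [hHat_zero]
    exact one_mem _
  · exact Algebra.subset_adjoin (Or.inl ⟨k, hk, rfl⟩)

theorem hatAlgebra_le_mixedAlgebra : hatAlgebra ≤ mixedAlgebra := by
  refine Algebra.adjoin_le ?_
  rintro _ ⟨k, rfl⟩
  exact hHat_mem_mixedAlgebra k

theorem barAlgebra_eq_map : barAlgebra = hatAlgebra.map (halfLam.restrictScalars ℤ) := by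
  have hs : ∀ n : ℕ, (-1 : QH) ^ n * (-1) ^ n = 1 := fun n => by rw [← mul_pow]; simp
  refine le_antisymm (Algebra.adjoin_le ?_) ?_
  · rintro _ ⟨k, -, rfl⟩
    rw [hBar_eq, if_pos (dvd_mul_right 2 k)]
    refine mul_mem (pow_mem (neg_mem (one_mem _)) _) ?_
    exact Subalgebra.mem_map.2 ⟨_, hHat_mem_hatAlgebra _, rfl⟩
  · rw [hatAlgebra, AlgHom.map_adjoin]
    refine Algebra.adjoin_le ?_
    rintro _ ⟨_, ⟨k, rfl⟩, rfl⟩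
    rcases Nat.eq_zero_or_pos k with rfl | hk
    · rw [hHat_zero, map_one]
      exact one_mem _
    · have h1 : hBar (2 * k) ∈ barAlgebra := Algebra.subset_adjoin ⟨k, hk, rfl⟩
      have h2 : halfLam (hHat k) = (-1) ^ k * hBar (2 * k) := by
        rw [hBar_eq, if_pos (dvd_mul_right 2 k), Nat.mul_div_cancel_left _ two_pos, ← mul_assoc,
          hs, one_mul]
      change halfLam (hHat k) ∈ barAlgebra
      rw [h2]
      exact mul_mem (pow_mem (neg_mem (one_mem _)) _) h1

theorem halfLam_mem_barAlgebra {x : QH} (hx : x ∈ hatAlgebra) : halfLam x ∈ barAlgebra := by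
  rw [barAlgebra_eq_map]
  exact Subalgebra.mem_map.2 ⟨x, hx, rfl⟩

theorem barAlgebra_eq_span :
    Subalgebra.toSubmodule barAlgebra =
      Submodule.span ℤ (Set.range fun k => halfLam (hatProd k)) := by
  rw [barAlgebra_eq_map, Subalgebra.map_toSubmodule, hatAlgebra_eq_hatSpan, hatSpan,
    Submodule.map_span, ← Set.range_comp]
  rfl

theorem lam_two_mul_hHat_mem_barAlgebra (m : ℕ+) (k : ℕ) : lam (2 * m) (hHat k) ∈ barAlgebra := by
  rw [lam_two_mul_hHat]
  exact sum_mem fun x _ => mul_mem (halfLam_mem_barAlgebra (lam_hHat_mem_hatAlgebra _ _))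
    (halfLam_mem_barAlgebra (lam_hHat_mem_hatAlgebra _ _))

end Halving

/-! ### Splitting exponents into odd and even indices. -/

section Parity

/-- Positive integers as odd numbers `2m - 1` and even numbers `2m`. -/
def parityEquiv : ℕ+ ⊕ ℕ+ ≃ ℕ+ :=
  Equiv.ofBijective (Sum.elim oddIndex (2 * ·)) (by
    have hodd : ∀ m, (oddIndex m : ℕ) = 2 * m - 1 := fun _ => rfl
    have heven : ∀ m : ℕ+, ((2 * m : ℕ+) : ℕ) = 2 * m := fun m => by simp
    constructor
    · rintro (a | a) (b | b) hab <;>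
        have hab' := congrArg (fun x : ℕ+ => (x : ℕ)) hab <;>
        simp only [Sum.elim_inl, Sum.elim_inr, hodd, heven] at hab' <;>
        have ha := a.pos <;> have hb := b.pos
      · exact congrArg _ (PNat.coe_injective (by omega))
      · omega
      · omega
      · exact congrArg _ (PNat.coe_injective (by omega))
    · intro n
      rcases Nat.even_or_odd' (n : ℕ) with ⟨c, hc | hc⟩
      · have hn := n.pos
        exact ⟨Sum.inr ⟨c, by omega⟩, PNat.coe_injective ((heven _).trans hc.symm)⟩
      · exact ⟨Sum.inl ⟨c + 1, by omega⟩, PNat.coe_injective ((hodd _).trans (by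
          rw [hc, PNat.mk_coe]
          omega))⟩)

/-- An exponent vector as the pair of its odd and even parts. -/
def exponentEquiv : (ℕ+ →₀ ℕ) × (ℕ+ →₀ ℕ) ≃ (ℕ+ →₀ ℕ) :=
  Finsupp.sumFinsuppEquivProdFinsupp.symm.trans (Finsupp.domCongr parityEquiv).toEquiv

theorem prod_exponentEquiv {M : Type*} [CommMonoid M] (k l : ℕ+ →₀ ℕ) (G : ℕ+ → ℕ → M) :
    (exponentEquiv (k, l)).prod G =
      k.prod (fun m => G (oddIndex m)) * l.prod fun m => G (2 * m) := by
  change (Finsupp.equivMapDomain parityEquiv (Finsupp.sumElim k l)).prod G = _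
  rw [Finsupp.prod_equivMapDomain, Finsupp.prod_sumElim]
  rfl

theorem bPrime_eq_prod (k : ℕ+ →₀ ℕ) :
    bPrime k = k.prod fun m n => if Odd (m : ℕ) then lam m (hHat n) else lam m (hCheck n) := by
  rw [bPrime, Finsupp.prod, prod_ite]
  simp only [Nat.not_odd_iff_even]

theorem oddIndex_odd (m : ℕ+) : Odd (oddIndex m : ℕ) :=
  ⟨m - 1, by have := m.pos; change 2 * (m : ℕ) - 1 = _; omega⟩

theorem bPrime_exponentEquiv (k l : ℕ+ →₀ ℕ) :
    bPrime (exponentEquiv (k, l)) = oddProd k * halfLam (hatProd l) := by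
  rw [bPrime_eq_prod, prod_exponentEquiv, hatProd, Finsupp.prod, Finsupp.prod, Finsupp.prod,
    map_prod, oddProd]
  congr 1
  · exact prod_congr rfl fun m _ => by rw [if_pos (oddIndex_odd m)]
  · refine prod_congr rfl fun m _ => ?_
    rw [if_neg (by simp [PNat.mul_coe]), halfLam_lam_hHat]

theorem lambdaSpan_eq_mul :
    lambdaSpan = Submodule.span ℤ (Set.range oddProd) * Subalgebra.toSubmodule barAlgebra := by
  rw [lambdaSpan, barAlgebra_eq_span, Submodule.span_mul_span]
  congr 1
  ext x
  simp only [Set.mem_range, Set.mem_mul, exists_exists_eq_and]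
  rw [exponentEquiv.surjective.exists]
  simp only [Prod.exists, bPrime_exponentEquiv]

/-- The odd indices give an odd product; the factors at even indices already lie in `ℤ[h̄_{2k}]`. -/
theorem hatSpan_le_mul :
    hatSpan ≤ Submodule.span ℤ (Set.range oddProd) * Subalgebra.toSubmodule barAlgebra := by
  rw [hatSpan, Submodule.span_le]
  rintro _ ⟨k, rfl⟩
  obtain ⟨⟨k, l⟩, rfl⟩ := exponentEquiv.surjective k
  rw [hatProd, prod_exponentEquiv]
  exact Submodule.mul_mem_mul (Submodule.subset_span ⟨k, rfl⟩)
    (Subalgebra.prod_mem _ fun m _ => lam_two_mul_hHat_mem_barAlgebra m _)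

theorem mixedAlgebra_eq_lambdaSpan : Subalgebra.toSubmodule mixedAlgebra = lambdaSpan := by
  apply le_antisymm
  · have h1 : Algebra.adjoin ℤ {x | ∃ r : ℕ, 0 < r ∧ x = hHat r} ≤ hatAlgebra :=
      Algebra.adjoin_le (by rintro _ ⟨r, -, rfl⟩; exact hHat_mem_hatAlgebra r)
    have h2 : Algebra.adjoin ℤ {x | ∃ r : ℕ, 0 < r ∧ x = hBar r} ≤ barAlgebra := by
      refine Algebra.adjoin_le ?_
      rintro _ ⟨r, -, rfl⟩
      change hBar r ∈ barAlgebra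
      rw [hBar_eq]
      split_ifs
      · exact mul_mem (pow_mem (neg_mem (one_mem _)) _)
          (halfLam_mem_barAlgebra (hHat_mem_hatAlgebra _))
      · exact zero_mem _
    -- Writing the bar algebra as its own square leaves one copy to absorb the even factors of the
    -- `ĥ` part and one for the `h̄_r`.
    rw [mixedAlgebra, Algebra.adjoin_union_coe_submodule, lambdaSpan_eq_mul,
      ← (Subalgebra.isIdempotentElem_toSubmodule barAlgebra).eq, ← mul_assoc]
    exact mul_le_mul' (((Subalgebra.toSubmodule.le_iff_le).2 h1).trans
      (hatAlgebra_le_hatSpan.trans hatSpan_le_mul)) ((Subalgebra.toSubmodule.le_iff_le).2 h2)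
  · rw [lambdaSpan_eq_mul, Submodule.mul_le]
    intro x hx y hy
    refine mixedAlgebra.mul_mem ?_ (barAlgebra_le_mixedAlgebra hy)
    have : Submodule.span ℤ (Set.range oddProd) ≤ Subalgebra.toSubmodule mixedAlgebra := by
      rw [Submodule.span_le]
      rintro _ ⟨k, rfl⟩
      exact Subalgebra.prod_mem _ fun m _ =>
        hatAlgebra_le_mixedAlgebra (lam_hHat_mem_hatAlgebra _ _)
    exact this hx

end Parity

/-! ### Leading terms for the total degree. -/

section Triangularity

open MvPolynomial

variable {σ R : Type*} [CommRing R]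

/-- The term with exponent `k` occurs in `p`, and every other term has smaller degree. -/
def HasLeadingExponent (k : σ →₀ ℕ) (p : MvPolynomial σ R) : Prop :=
  coeff k p ≠ 0 ∧ ∀ j, k.degree ≤ j.degree → j ≠ k → coeff j p = 0

namespace HasLeadingExponent

theorem one [Nontrivial R] : HasLeadingExponent (0 : σ →₀ ℕ) (1 : MvPolynomial σ R) := by
  classical
  refine ⟨by simp, fun j _ hj => ?_⟩
  rw [coeff_one, if_neg hj.symm]

theorem mul [IsDomain R] {k l : σ →₀ ℕ} {p q : MvPolynomial σ R} (hp : HasLeadingExponent k p)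
    (hq : HasLeadingExponent l q) : HasLeadingExponent (k + l) (p * q) := by
  classical
  have key : ∀ j : σ →₀ ℕ, (k + l).degree ≤ j.degree →
      ∀ x ∈ HasAntidiagonal.antidiagonal j, x ≠ (k, l) →
      coeff x.1 p * coeff x.2 q = 0 := by
    rintro j hj ⟨a, b⟩ hx hne
    rw [HasAntidiagonal.mem_antidiagonal] at hx
    subst hx
    simp only [map_add] at hj
    -- If the exponents are not `(k, l)`, one of them has at least the leading degree without being
    -- the leading exponent.
    by_cases ha : a = k
    · have hb : b ≠ l := fun hb => hne (by rw [ha, hb])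
      subst ha
      rw [hq.2 b (by omega) hb, mul_zero]
    · rcases le_or_gt k.degree a.degree with h | h
      · rw [hp.2 a h ha, zero_mul]
      · rw [hq.2 b (by omega) (by rintro rfl; omega), mul_zero]
  constructor
  · rw [coeff_mul, sum_eq_single (k, l) (key _ le_rfl) (by simp)]
    exact mul_ne_zero hp.1 hq.1
  · intro j hj hne
    rw [coeff_mul]
    refine sum_eq_zero fun x hx => key j hj x hx ?_
    rintro rfl
    exact hne (HasAntidiagonal.mem_antidiagonal.1 hx).symm

theorem prod [IsDomain R] {ι : Type*} (s : Finset ι) {k : ι → σ →₀ ℕ}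
    {p : ι → MvPolynomial σ R} (h : ∀ i ∈ s, HasLeadingExponent (k i) (p i)) :
    HasLeadingExponent (∑ i ∈ s, k i) (∏ i ∈ s, p i) := by
  classical
  induction s using Finset.induction_on with
  | empty => simpa using one
  | insert a s ha ih =>
    rw [sum_insert ha, prod_insert ha]
    exact (h a (mem_insert_self a s)).mul (ih fun i hi => h i (mem_insert_of_mem hi))

theorem linearIndependent [IsDomain R] {b : (σ →₀ ℕ) → MvPolynomial σ R}
    (h : ∀ k, HasLeadingExponent k (b k)) : LinearIndependent R b := by
  classical
  rw [linearIndependent_iff']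
  intro s g hg
  by_contra! hne
  obtain ⟨i, hi, hi0⟩ := hne
  -- At an index of maximal degree, no other term of the relation can cancel the leading monomial.
  obtain ⟨k, hk, hmax⟩ := exists_max_image (s.filter fun i => g i ≠ 0) Finsupp.degree
    ⟨i, mem_filter.2 ⟨hi, hi0⟩⟩
  rw [mem_filter] at hk
  have := congrArg (coeff k) hg
  rw [coeff_sum, coeff_zero, sum_eq_single k] at this
  · rw [coeff_smul, smul_eq_mul] at this
    exact (mul_ne_zero hk.2 (h k).1) this
  · intro j hj hjk
    rw [coeff_smul, smul_eq_mul]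
    by_cases h0 : g j = 0
    · rw [h0, zero_mul]
    · rw [(h j).2 k (hmax j (mem_filter.2 ⟨hj, h0⟩)) hjk.symm, mul_zero]
  · exact fun h1 => absurd hk.1 h1

theorem span_eq_top {K : Type*} [Field K] {b : (σ →₀ ℕ) → MvPolynomial σ K}
    (h : ∀ k, HasLeadingExponent k (b k)) : Submodule.span K (Set.range b) = ⊤ := by
  classical
  have key : ∀ n, ∀ k : σ →₀ ℕ, k.degree = n →
      monomial k (1 : K) ∈ Submodule.span K (Set.range b) := by
    intro n
    induction n using Nat.strong_induction_on with
    | _ n ih =>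
      rintro k rfl
      have hsum := (b k).as_sum
      rw [← add_sum_erase _ _ (mem_support_iff.2 (h k).1), ← sub_eq_iff_eq_add] at hsum
      have hmono : monomial k (1 : K) = (coeff k (b k))⁻¹ • monomial k (coeff k (b k)) := by
        rw [smul_monomial, smul_eq_mul, inv_mul_cancel₀ (h k).1]
      rw [hmono, ← hsum]
      refine Submodule.smul_mem _ _ (Submodule.sub_mem _ (Submodule.subset_span ⟨k, rfl⟩)
        (Submodule.sum_mem _ fun j hj => ?_))
      rw [mem_erase, mem_support_iff] at hj
      have hlt : j.degree < k.degree := by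
        by_contra hle
        exact hj.2 ((h k).2 j (not_lt.1 hle) hj.1)
      have : monomial j (coeff j (b k)) = coeff j (b k) • monomial j (1 : K) := by
        rw [smul_monomial, smul_eq_mul, mul_one]
      rw [this]
      exact Submodule.smul_mem _ _ (ih _ hlt j rfl)
  rw [eq_top_iff]
  rintro p -
  rw [p.as_sum]
  refine Submodule.sum_mem _ fun j _ => ?_
  have : monomial j (coeff j p) = coeff j p • monomial j (1 : K) := by
    rw [smul_monomial, smul_eq_mul, mul_one]
  rw [this]
  exact Submodule.smul_mem _ _ (key _ j rfl)

end HasLeadingExponent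

/-- In `n f_n = ∑ ± c h_{mi} f_{n-i}` the `i`-th summand has degree at most `1 + (n - i)`. Only `i =
1` reaches degree `n`, so the leading term is a nonzero multiple of `h_m^n`. -/
theorem hasLeadingExponent_of_isLogExp (m : ℕ+) (c : ℚ) (hc : c ≠ 0) {f : PowerSeries QH}
    (hf : IsLogExp (powerSumSeries fun r => c • hN (m * r)) f) (n : ℕ) :
    HasLeadingExponent (Finsupp.single m n) (PowerSeries.coeff n f) := by
  classical
  induction n using Nat.strong_induction_on with
  | _ n ih =>
    rcases n with _ | n
    · rw [PowerSeries.coeff_zero_eq_constantCoeff_apply, hf.1, Finsupp.single_zero]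
      exact HasLeadingExponent.one
    have hX : HasLeadingExponent (Finsupp.single m 1) (c • (X m : QH)) := by
      refine ⟨by simpa using hc, fun j _ hj => ?_⟩
      rw [coeff_smul, coeff_X, if_neg hj.symm, smul_zero]
    have hlead := hX.mul (ih n (Nat.lt_succ_self n))
    rw [← Finsupp.single_add, add_comm 1 n] at hlead
    have hcoeff : ∀ d : ℕ+ →₀ ℕ, n + 1 ≤ d.degree →
        ((n + 1 : ℕ) : ℚ) * coeff d (PowerSeries.coeff (n + 1) f) =
          coeff d (c • (X m : QH) * PowerSeries.coeff n f) := by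
      intro d hd
      have h1 := congrArg (coeff d) (hf.coeff_mul (n + 1))
      rw [← map_natCast (C : ℚ →+* QH), coeff_C_mul, coeff_sum] at h1
      rw [h1, sum_eq_single (1, n)]
      · rw [coeff_powerSumSeries]
        simp only [mul_one, hN_coe, Nat.sub_self, pow_zero, one_mul]
        rfl
      · rintro ⟨i, j⟩ hij hne
        rw [HasAntidiagonal.mem_antidiagonal] at hij
        simp only at hij
        rcases Nat.eq_zero_or_pos i with rfl | hi
        · simp [coeff_powerSumSeries, hN_zero]
        · have hj : j < n := by
            rcases Nat.lt_or_ge j n with h | h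
            · exact h
            · exact absurd (Prod.ext (by simp only; omega) (by simp only; omega)) hne
          obtain ⟨i, rfl⟩ : ∃ s : ℕ+, (s : ℕ) = i := ⟨⟨i, hi⟩, rfl⟩
          have hrw : PowerSeries.coeff (i : ℕ) (powerSumSeries fun r => c • hN (m * r)) =
              C ((-1) ^ ((i : ℕ) - 1) * c) * X (m * i) := by
            rw [coeff_powerSumSeries, ← PNat.mul_coe, hN_coe, MvPolynomial.smul_eq_C_mul, h]
            simp only [map_mul, map_pow, map_neg, map_one]
            ring
          simp only
          rw [hrw, mul_assoc, coeff_C_mul, coeff_X_mul']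
          split_ifs with hs
          · have hle : Finsupp.single (m * i) 1 ≤ d := by
              rw [Finsupp.single_le_iff]
              exact Nat.one_le_iff_ne_zero.2 (Finsupp.mem_support_iff.1 hs)
            have hdeg : (d - Finsupp.single (m * i) 1).degree + 1 = d.degree := by
              conv_rhs => rw [← tsub_add_cancel_of_le hle]
              rw [map_add, Finsupp.degree_single]
            rw [(ih j (by omega)).2, mul_zero]
            · rw [Finsupp.degree_single]
              omega
            · intro heq
              rw [heq, Finsupp.degree_single] at hdeg
              omega
          · rw [mul_zero]
      · intro h2
        exact absurd (HasAntidiagonal.mem_antidiagonal.2 (add_comm 1 n)) h2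
    have hn : ((n + 1 : ℕ) : ℚ) ≠ 0 := by exact_mod_cast Nat.succ_ne_zero n
    refine ⟨fun h0 => ?_, fun j hj hne => ?_⟩
    · have := hcoeff (Finsupp.single m (n + 1)) (by rw [Finsupp.degree_single])
      rw [h0, mul_zero] at this
      exact hlead.1 this.symm
    · have := hcoeff j (by rwa [Finsupp.degree_single] at hj)
      rw [hlead.2 j hj hne] at this
      exact (mul_eq_zero.1 this).resolve_left hn

theorem hasLeadingExponent_lam_hHat (m : ℕ+) (n : ℕ) :
    HasLeadingExponent (Finsupp.single m n) (lam m (hHat n)) := by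
  have h1 : IsLogExp (PowerSeries.map (lam m : QH →+* QH) (powerSumSeries hN)) _ :=
    isLogExp_hHat.map _
  rw [map_powerSumSeries] at h1
  refine hasLeadingExponent_of_isLogExp m 1 one_ne_zero (f := PowerSeries.map (lam m : QH →+* QH) _)
    ?_ n
  convert h1 using 2
  ext1 r
  simp [lam_hN]

theorem hasLeadingExponent_lam_hCheck (m : ℕ+) (n : ℕ) :
    HasLeadingExponent (Finsupp.single m n) (lam m (hCheck n)) := by
  have h1 : IsLogExp (PowerSeries.map (lam m : QH →+* QH)
    (powerSumSeries fun r => (1 / 2 : ℚ) • hN r)) _ := isLogExp_hCheck.map _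
  rw [map_powerSumSeries] at h1
  refine hasLeadingExponent_of_isLogExp m (1 / 2) (by norm_num)
    (f := PowerSeries.map (lam m : QH →+* QH) _) ?_ n
  convert h1 using 2
  ext1 r
  simp [lam_hN]

theorem hasLeadingExponent_bPrime (k : ℕ+ →₀ ℕ) : HasLeadingExponent k (bPrime k) := by
  rw [bPrime_eq_prod, Finsupp.prod]
  nth_rw 1 [← Finsupp.sum_single k]
  refine HasLeadingExponent.prod _ fun m _ => ?_
  split_ifs
  · exact hasLeadingExponent_lam_hHat m _
  · exact hasLeadingExponent_lam_hCheck m _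

end Triangularity

/-! ### The bases over `ℚ`, `ℤ` and `ℤ[h̄_{2k}]`. -/

section Bases

/-- The `ℚ`-basis `b'_k` of `ℚ[h_r | r > 0]`. -/
def bPrimeBasis : Module.Basis (ℕ+ →₀ ℕ) ℚ QH :=
  Module.Basis.mk (HasLeadingExponent.linearIndependent hasLeadingExponent_bPrime)
    (HasLeadingExponent.span_eq_top hasLeadingExponent_bPrime).ge

theorem coe_bPrimeBasis : (bPrimeBasis : (ℕ+ →₀ ℕ) → QH) = bPrime := Module.Basis.coe_mk _ _

theorem linearIndependent_bPrime : LinearIndependent ℤ bPrime := by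
  have := bPrimeBasis.linearIndependent.restrict_scalars' ℤ
  rwa [coe_bPrimeBasis] at this

theorem bPrime_mem_mixedAlgebra (k : ℕ+ →₀ ℕ) : bPrime k ∈ mixedAlgebra := by
  change bPrime k ∈ Subalgebra.toSubmodule mixedAlgebra
  rw [mixedAlgebra_eq_lambdaSpan]
  exact Submodule.subset_span ⟨k, rfl⟩

/-- The `ℤ`-basis `b'_k` of the mixed algebra. -/
def mixedBasis : Module.Basis (ℕ+ →₀ ℕ) ℤ mixedAlgebra :=
  Module.Basis.mk (v := fun k => ⟨bPrime k, bPrime_mem_mixedAlgebra k⟩)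
    (LinearIndependent.of_comp mixedAlgebra.val.toLinearMap linearIndependent_bPrime) (by
      rintro ⟨x, hx⟩ -
      have hx' : x ∈ lambdaSpan := mixedAlgebra_eq_lambdaSpan ▸ hx
      have hmap : x ∈ Submodule.map mixedAlgebra.val.toLinearMap (Submodule.span ℤ (Set.range
          (fun k => (⟨bPrime k, bPrime_mem_mixedAlgebra k⟩ : mixedAlgebra)))) := by
        rw [Submodule.map_span, ← Set.range_comp]
        exact hx'
      obtain ⟨y, hy, hyx⟩ := hmap
      have hyx' : y = ⟨x, hx⟩ := Subtype.ext hyx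
      exact hyx' ▸ hy)

theorem coe_mixedBasis (k : ℕ+ →₀ ℕ) : (mixedBasis k : QH) = bPrime k := by
  rw [mixedBasis, Module.Basis.mk_apply]

theorem isIntegralForm_mixedAlgebra : IsIntegralForm mixedAlgebra := by
  refine ⟨Module.Free.of_basis mixedBasis, ?_⟩
  -- In the two bases `b'_k` the inclusion is the standard map from `ℤ`-coordinates into a
  -- `ℚ`-space, which is a base change.
  have hval : mixedAlgebra.val.toLinearMap =
      Finsupp.linearCombination ℤ bPrimeBasis ∘ₗ mixedBasis.repr.toLinearMap :=
    mixedBasis.ext fun k => by simp [coe_mixedBasis, coe_bPrimeBasis]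
  have hbase : IsBaseChange ℚ mixedAlgebra.val.toLinearMap := by
    rw [hval]
    exact IsBaseChange.comp_equiv (S := ℚ) mixedBasis.repr _
      (IsBaseChange.of_basis ℤ bPrimeBasis)
  exact hbase

/-- Expanding the coefficients in the spanning set of `ℤ[h̄_{2k}]` turns a relation into a
`ℤ`-linear relation among the `b'_k`. -/
theorem linearIndependent_oddProd : LinearIndependent barAlgebra oddProd := by
  classical
  have hpair : LinearIndependent ℤ fun x : (ℕ+ →₀ ℕ) × (ℕ+ →₀ ℕ) =>
      oddProd x.1 * halfLam (hatProd x.2) := by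
    have := linearIndependent_bPrime.comp _ exponentEquiv.injective
    convert this using 2 with x
    exact (bPrime_exponentEquiv x.1 x.2).symm
  have hrepr : ∀ y : barAlgebra, ∃ r : (ℕ+ →₀ ℕ) →₀ ℤ,
      (r.sum fun l a => a • halfLam (hatProd l)) = y := fun y => by
    have hy : (y : QH) ∈ Subalgebra.toSubmodule barAlgebra := y.2
    rw [barAlgebra_eq_span, Finsupp.mem_span_range_iff_exists_finsupp] at hy
    exact hy
  choose r hr using hrepr
  rw [linearIndependent_iff']
  intro s g hg k hk
  -- One finite index set serves all the coefficients, so the relation becomes a sum over a product.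
  set T := s.biUnion fun k => (r (g k)).support
  have hT : ∀ k ∈ s, ∑ l ∈ T, r (g k) l • halfLam (hatProd l) = g k := fun k hk => by
    rw [← hr (g k)]
    exact (Finsupp.sum_of_support_subset _ (subset_biUnion_of_mem (fun k => (r (g k)).support) hk)
      (fun l a => a • halfLam (hatProd l)) (fun _ _ => zero_smul _ _)).symm
  have h0 : ∑ x ∈ s ×ˢ T, r (g x.1) x.2 • (oddProd x.1 * halfLam (hatProd x.2)) = 0 := by
    rw [← hg, sum_product]
    refine sum_congr rfl fun k hk => ?_
    rw [Subalgebra.smul_def, ← hT k hk, smul_eq_mul, sum_mul]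
    exact sum_congr rfl fun l _ => by rw [smul_mul_assoc, mul_comm]
  have hz := linearIndependent_iff'.1 hpair (s ×ˢ T) (fun x => r (g x.1) x.2) h0
  apply Subtype.ext
  rw [← hT k hk]
  exact sum_eq_zero fun l hl => by
    rw [hz (k, l) (mem_product.2 ⟨hk, hl⟩), zero_smul]

theorem oddProd_mem_mixedModule (k : ℕ+ →₀ ℕ) : oddProd k ∈ mixedModule :=
  mixedAlgebra.prod_mem fun _ _ => hatAlgebra_le_mixedAlgebra (lam_hHat_mem_hatAlgebra _ _)

theorem mem_span_oddProd {x : QH} (hx : x ∈ mixedModule) :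
    x ∈ Submodule.span barAlgebra (Set.range oddProd) := by
  have hx' : x ∈ Subalgebra.toSubmodule mixedAlgebra := hx
  rw [mixedAlgebra_eq_lambdaSpan, lambdaSpan] at hx'
  refine Submodule.span_induction ?_ (zero_mem _) (fun _ _ _ _ => add_mem)
    (fun a _ _ h => zsmul_mem h a) hx'
  rintro _ ⟨k, rfl⟩
  obtain ⟨⟨k, l⟩, rfl⟩ := exponentEquiv.surjective k
  have hl : halfLam (hatProd l) ∈ barAlgebra := by
    change _ ∈ Subalgebra.toSubmodule barAlgebra
    rw [barAlgebra_eq_span]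
    exact Submodule.subset_span ⟨l, rfl⟩
  rw [bPrime_exponentEquiv, mul_comm]
  exact Submodule.smul_mem _ (⟨_, hl⟩ : barAlgebra) (Submodule.subset_span ⟨k, rfl⟩)

/-- The basis `∏_{m > 0} λ_{2m-1}(ĥ_{k_m})` of the mixed algebra over `ℤ[h̄_{2k} | k > 0]`. -/
def oddBasis : Module.Basis (ℕ+ →₀ ℕ) barAlgebra mixedModule :=
  Module.Basis.mk (v := fun k => ⟨oddProd k, oddProd_mem_mixedModule k⟩)
    (LinearIndependent.of_comp mixedModule.subtype linearIndependent_oddProd) (by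
      rintro ⟨x, hx⟩ -
      have hmap : x ∈ Submodule.map mixedModule.subtype (Submodule.span barAlgebra (Set.range
          (fun k => (⟨oddProd k, oddProd_mem_mixedModule k⟩ : mixedModule)))) := by
        rw [Submodule.map_span, ← Set.range_comp]
        exact mem_span_oddProd hx
      obtain ⟨y, hy, hyx⟩ := hmap
      have hyx' : y = ⟨x, hx⟩ := Subtype.ext hyx
      exact hyx' ▸ hy)

theorem coe_oddBasis (k : ℕ+ →₀ ℕ) : (oddBasis k : QH) = oddProd k := by
  rw [oddBasis, Module.Basis.mk_apply]

end Bases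

end MixedSym

end

theorem mainTheorem6 :
    Subalgebra.toSubmodule MixedSym.mixedAlgebra = MixedSym.lambdaSpan ∧
    MixedSym.IsIntegralForm MixedSym.mixedAlgebra ∧
    (∃ b : Module.Basis (ℕ+ →₀ ℕ) ℤ MixedSym.mixedAlgebra,
      ∀ k, (b k : MixedSym.QH) = MixedSym.bPrime k) ∧
    (∃ c : Module.Basis (ℕ+ →₀ ℕ) MixedSym.barAlgebra MixedSym.mixedModule,
      ∀ k, (c k : MixedSym.QH) = MixedSym.oddProd k) :=
  ⟨MixedSym.mixedAlgebra_eq_lambdaSpan, MixedSym.isIntegralForm_mixedAlgebra,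
    ⟨MixedSym.mixedBasis, MixedSym.coe_mixedBasis⟩, ⟨MixedSym.oddBasis, MixedSym.coe_oddBasis⟩⟩
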